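/- Let $F$ be a field of characteristic $2$, let $E/F$ be a finite Galois extension with group $G=\mathrm{Gal}(E/F)$, acting by $c^\sigma=\sigma(c)$ and with products in $G$ written so that $c^{\sigma\tau}=(c^\sigma)^\tau$. Let $\Phi\colon G\times G\to E^\times$ be a factor set ($2$-cocycle), that is $\Phi(\sigma\tau,\upsilon)\,\Phi(\sigma,\tau)^\upsilon=\Phi(\sigma,\tau\upsilon)\,\Phi(\tau,\upsilon)$, and let $A=(E,G,\Phi)=\bigoplus_{\sigma\in G}u_\sigma E$ be the crossed product, with $c\,u_\sigma=u_\sigma\,\sigma(c)$ and $u_\sigma u_\tau=u_{\sigma\tau}\Phi(\sigma,\tau)$ for $c\in E$, $\sigma,\tau\in G$. For a central simple $F$-algebra $A$ of degree $n$ (so $\dim_FA=n^2$) and $a\in A$, let $\mathrm{Prd}_{A,a}(x)=x^n-t_1(a)x^{n-1}+t_2(a)x^{n-2}-\cdots\in F[x]$ be the reduced polynomial of $a$, i.e. the characteristic polynomial of the image of $a$ in $M_n(K)\cong A\otimes_FK$ for a splitting field $K$ of $A$; it has coefficients in $F$ and does not depend on $K$ or on the isomorphism. The map $t_1$ is linear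 and $t_2$ is a quadratic form ($t_2=0$ if $n=1$). Let $T_{A/F}$ be the quadratic form $(A,t_2)$ if $n$ is even, and $(\ker t_1,t_2)$ if $n$ is odd. Similarly let $T_1(a)=\mathrm{tr}_{E/F}(a)$ and $T_2(a)$ be the first and second coefficients (those of $x^{[E:F]-1}$ and $x^{[E:F]-2}$, with $T_2=0$ if $E=F$) of the characteristic polynomial of multiplication by $a\in E$, and let Revoy's form $T_{E/F}$ be $(E,T_2)$ if $[E:F]$ is even, and $(\ker T_1,T_2)$ if $[E:F]$ is odd. Two nonsingular quadratic forms over $F$ (their polar bilinear forms are nondegenerate) are Witt equivalent if they become isometric after adding to each of them some number of hyperbolic planes. Then, for the crossed product $A=(E,G,\Phi)$: 1. if $[E:F]$ is even, $T_{A/F}$ is Witt equivalent to $T_{E/F}\perp(B,t_2)$, where $B$ is the $F$-subspace of $A$ spanned by all $u_\rho e$ with $e\in E$, $\rho\in G$, $\rho^2=\mathrm{id}$, $\rho\neq\mathrm{id}$; 2. if $[E:F]$ is odd, $T_{A/F}$ is Witt equivalent to $T_{E/F}$. (In both cases all the forms that occur are nonsingular.) -/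

import Mathlib

open scoped TensorProduct Polynomial

universe u v w

/-! ### Quadratic forms: nonsingularity, hyperbolic planes, Witt equivalence -/

section Witt

variable {F : Type u} [Field F]

/-- The quadratic form `Q` is nonsingular: its polar bilinear form is nondegenerate. -/
def Nonsingular {V : Type v} [AddCommGroup V] [Module F V] (Q : QuadraticForm F V) : Prop :=
  Q.polarBilin.Nondegenerate

variable (F) in
/-- The hyperbolic plane `x * y` on `F × F`. -/
def hyperbolicPlane : QuadraticForm F (F × F) :=
  QuadraticMap.linMulLin (LinearMap.fst F F F) (LinearMap.snd F F F)

variable (F) in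
/-- The orthogonal sum of `m` hyperbolic planes. -/
def hyperbolicSpace (m : ℕ) : QuadraticForm F (Fin m → F × F) :=
  QuadraticMap.pi fun _ => hyperbolicPlane F

/-- Two nonsingular quadratic forms are Witt equivalent if they become isometric after
adding hyperbolic planes to both of them. -/
def WittEquivalent {V : Type v} {W : Type w} [AddCommGroup V] [Module F V] [AddCommGroup W]
    [Module F W] (Q : QuadraticForm F V) (Q' : QuadraticForm F W) : Prop :=
  Nonsingular Q ∧ Nonsingular Q' ∧
    ∃ m m' : ℕ, (Q.prod (hyperbolicSpace F m)).Equivalent (Q'.prod (hyperbolicSpace F m'))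

end Witt

/-- For a polynomial `p = x ^ n - s₁ x ^ (n - 1) + s₂ x ^ (n - 2) - ⋯ + (-1) ^ n sₙ`, the
element `sₖ` (and `0` if `k > n`, where there is no such term). -/
def signedCoeff {F : Type u} [Field F] (n k : ℕ) (p : F[X]) : F :=
  if k ≤ n then (-1) ^ k * p.coeff (n - k) else 0

/-! ### The second trace form of a field extension -/

section Extension

variable (F : Type u) (E : Type v) [Field F] [Field E] [Algebra F E]

/-- `T₂ a`: the second coefficient of the characteristic polynomial of
multiplication by `a` on `E` over `F`. -/
noncomputable def extSecondCoeff [FiniteDimensional F E] (a : E) : F :=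
  signedCoeff (Module.finrank F E) 2 (Algebra.lmul F E a).charpoly

theorem exists_extSecondForm [FiniteDimensional F E] :
    ∃ Q : QuadraticForm F E, ∀ a, Q a = extSecondCoeff F E a := by
  classical
  by_cases hn : 2 ≤ Module.finrank F E
  swap
  · exact ⟨0, fun a => by simp [extSecondCoeff, signedCoeff, hn]⟩
  let b := Module.finBasis F E
  have key : ∀ s ∈ (Finset.univ : Finset (Fin (Module.finrank F E))).powersetCard 2,
      ∃ Q : QuadraticForm F E, ∀ a, Q a =
        ((Algebra.leftMulMatrix b a).submatrix (Subtype.val : s → _) Subtype.val).det := by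
    intro s hs
    have hc : Fintype.card s = 2 := by simpa using (Finset.mem_powersetCard.mp hs).2
    let e : Fin 2 ≃ s := (Fintype.equivFinOfCardEq hc).symm
    let L : (i j : Fin 2) → (E →ₗ[F] F) := fun i j =>
      (Matrix.entryLinearMap F F (e i : Fin (Module.finrank F E))
        (e j : Fin (Module.finrank F E))) ∘ₗ
        (Algebra.leftMulMatrix b).toLinearMap
    refine ⟨QuadraticMap.linMulLin (L 0 0) (L 1 1) - QuadraticMap.linMulLin (L 0 1) (L 1 0),
      fun a => ?_⟩
    rw [← Matrix.det_submatrix_equiv_self e, Matrix.det_fin_two]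
    simp [L]
  choose! Q hQ using key
  refine ⟨∑ s ∈ Finset.univ.powersetCard 2, Q s, fun a => ?_⟩
  have h1 : (Algebra.lmul F E a).charpoly = (Algebra.leftMulMatrix b a).charpoly := by
    rw [← LinearMap.charpoly_toMatrix _ b]; rfl
  have h2 := Matrix.charpoly_coeff_eq_sum_minors (Algebra.leftMulMatrix b a) 2 (by simpa using hn)
  rw [Fintype.card_fin] at h2
  rw [extSecondCoeff, signedCoeff, if_pos hn, h1, h2, sum_apply,
    Finset.sum_congr rfl (fun s hs => hQ s hs a)]
  ring

/-- The quadratic form `T₂` on `E`. -/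
noncomputable def extSecondForm [FiniteDimensional F E] : QuadraticForm F E where
  toFun := extSecondCoeff F E
  toFun_smul a x := by
    obtain ⟨Q, hQ⟩ := exists_extSecondForm F E
    rw [← hQ, ← hQ, Q.map_smul]
  exists_companion' := by
    obtain ⟨Q, hQ⟩ := exists_extSecondForm F E
    simp only [← hQ]
    exact Q.exists_companion

/-- The underlying space of `T_{E/F}`: `E` if `[E : F]` is even, and the kernel of the trace
if `[E : F]` is odd. -/
noncomputable def extTraceSpace : Submodule F E :=
  if Even (Module.finrank F E) then ⊤ else LinearMap.ker (Algebra.trace F E)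

/-- The second trace form `T_{E/F}` of a field extension. -/
noncomputable def extTraceForm [FiniteDimensional F E] : QuadraticForm F (extTraceSpace F E) :=
  (extSecondForm F E).restrict (extTraceSpace F E)

end Extension

/-! ### The second trace form of a central simple algebra -/

section Algebra

variable (F : Type u) {A : Type v} [Field F] [Ring A] [Algebra F A]

/-- `p ∈ F[x]` is the reduced polynomial of `a`: it is the characteristic polynomial of the image
of `a` under a splitting representation `a ↦ ψ (1 ⊗ a)` over a splitting field `K` of `A`. -/
def IsReducedCharpoly (a : A) (p : F[X]) : Prop :=
  ∃ (K : Type u) (_ : Field K) (_ : Algebra F K) (n : ℕ)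
    (ψ : K ⊗[F] A ≃ₐ[K] Matrix (Fin n) (Fin n) K),
    p.map (algebraMap F K) = (ψ (1 ⊗ₜ[F] a)).charpoly

open Classical in
/-- The reduced polynomial of `a`. -/
noncomputable def reducedCharpoly (a : A) : F[X] :=
  if h : ∃ p, IsReducedCharpoly F a p then h.choose else 0

variable (A)

/-- The degree `n` of a central simple algebra of dimension `n ^ 2`. -/
noncomputable def algDegree : ℕ := Nat.sqrt (Module.finrank F A)

/-- The coefficient `tₖ` of the reduced polynomial, as a function on `A`. -/
noncomputable def reducedCoeff (k : ℕ) (a : A) : F :=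
  signedCoeff (algDegree F A) k (reducedCharpoly F a)

open Classical in
/-- The reduced trace `t₁`, bundled as a linear map. -/
noncomputable def reducedTrace : A →ₗ[F] F :=
  if h : ∃ f : A →ₗ[F] F, ∀ a, f a = reducedCoeff F A 1 a then h.choose else 0

open Classical in
/-- The second coefficient `t₂`, bundled as a quadratic form. -/
noncomputable def reducedSecondForm : QuadraticForm F A :=
  if h : ∃ Q : QuadraticForm F A, ∀ a, Q a = reducedCoeff F A 2 a then h.choose else 0

/-- None of the choices above falls back on its default value: every element of `A` has exactly
one reduced polynomial (it has coefficients in `F` and does not depend on the splitting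
representation), `t₁` is linear and `t₂` is a quadratic form. -/
structure HasReducedForms : Prop where
  existsUnique_charpoly : ∀ a : A, ∃! p : F[X], IsReducedCharpoly F a p
  trace_apply : ∀ a : A, reducedTrace F A a = reducedCoeff F A 1 a
  second_apply : ∀ a : A, reducedSecondForm F A a = reducedCoeff F A 2 a

/-- The underlying space of `T_{A/F}`: `A` if `deg A` is even, and `A₀ = ker t₁`
if `deg A` is odd. -/
noncomputable def algTraceSpace : Submodule F A :=
  if Even (algDegree F A) then ⊤ else LinearMap.ker (reducedTrace F A)

/-- The second trace form `T_{A/F}` of a central simple algebra. -/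
noncomputable def algTraceForm : QuadraticForm F (algTraceSpace F A) :=
  (reducedSecondForm F A).restrict (algTraceSpace F A)

end Algebra

/-! ### Crossed products

The Galois group acts on exponents, `c ^ σ = σ c` and `c ^ (στ) = (c ^ σ) ^ τ`, as the relation
`u_σ⁻¹ c u_σ = σ c` requires. So the product `στ` (first `σ`, then `τ`) is Mathlib's `τ * σ`. -/

/-- A factor set: a 2-cocycle of the Galois group of `E/F` with values in `Eˣ`
(not assumed to be normalized). -/
structure FactorSet (F : Type u) (E : Type v) [Field F] [Field E] [Algebra F E] where
  /-- the values `Φ(σ, τ)` -/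
  toFun : (E ≃ₐ[F] E) → (E ≃ₐ[F] E) → Eˣ
  cocycle : ∀ σ τ υ : E ≃ₐ[F] E,
    (toFun (τ * σ) υ : E) * υ (toFun σ τ) = toFun σ (υ * τ) * toFun τ υ

/-- The crossed product `(E, G, Φ) = ⨁ u_σ E`; the function `x` stands for `∑ u_σ x_σ`. -/
def CrossedProduct {F : Type u} {E : Type v} [Field F] [Field E] [Algebra F E]
    (_Φ : FactorSet F E) : Type v :=
  (E ≃ₐ[F] E) → E

namespace CrossedProduct

variable {F : Type u} {E : Type v} [Field F] [Field E] [Algebra F E] (Φ : FactorSet F E)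

instance : AddCommGroup (CrossedProduct Φ) :=
  inferInstanceAs (AddCommGroup ((E ≃ₐ[F] E) → E))

instance : Module F (CrossedProduct Φ) :=
  inferInstanceAs (Module F ((E ≃ₐ[F] E) → E))

variable {Φ} in
@[ext] theorem ext {x y : CrossedProduct Φ} (h : ∀ σ, x σ = y σ) : x = y := funext h

@[simp] theorem add_apply (x y : CrossedProduct Φ) (σ : E ≃ₐ[F] E) : (x + y) σ = x σ + y σ := rfl

@[simp] theorem zero_apply (σ : E ≃ₐ[F] E) : (0 : CrossedProduct Φ) σ = 0 := rfl

@[simp] theorem smul_apply (r : F) (x : CrossedProduct Φ) (σ : E ≃ₐ[F] E) :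
    (r • x) σ = r • x σ := rfl

open Classical in
/-- The element `u_σ e`. -/
noncomputable def monomial (σ : E ≃ₐ[F] E) (e : E) : CrossedProduct Φ :=
  fun τ => if τ = σ then e else 0

/-- The unit element `u_id Φ(id, id)⁻¹`. -/
noncomputable instance : One (CrossedProduct Φ) :=
  ⟨monomial Φ 1 (Φ.toFun 1 1 : E)⁻¹⟩

theorem one_def : (1 : CrossedProduct Φ) = monomial Φ 1 (Φ.toFun 1 1 : E)⁻¹ := rfl

theorem factor_one_left (τ : E ≃ₐ[F] E) : (Φ.toFun 1 τ : E) = τ (Φ.toFun 1 1) := by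
  have h := Φ.cocycle 1 1 τ
  simp only [mul_one] at h
  exact (mul_left_cancel₀ (Units.ne_zero _) h).symm

theorem factor_one_right (σ : E ≃ₐ[F] E) : (Φ.toFun σ 1 : E) = Φ.toFun 1 1 := by
  have h := Φ.cocycle σ 1 1
  simp only [one_mul, AlgEquiv.one_apply] at h
  exact mul_left_cancel₀ (Units.ne_zero _) h

variable [FiniteDimensional F E]

/-- The product determined by `(u_σ c) (u_τ d) = u_{στ} Φ(σ, τ) τ(c) d`. -/
noncomputable instance : Mul (CrossedProduct Φ) :=
  ⟨fun x y υ => ∑ τ, (Φ.toFun (τ⁻¹ * υ) τ : E) * τ (x (τ⁻¹ * υ)) * y τ⟩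

theorem mul_apply (x y : CrossedProduct Φ) (υ : E ≃ₐ[F] E) :
    (x * y) υ = ∑ τ, (Φ.toFun (τ⁻¹ * υ) τ : E) * τ (x (τ⁻¹ * υ)) * y τ := rfl

theorem monomial_mul_monomial (σ τ : E ≃ₐ[F] E) (c d : E) :
    monomial Φ σ c * monomial Φ τ d = monomial Φ (τ * σ) (Φ.toFun σ τ * τ c * d) := by
  ext υ
  rw [mul_apply, Finset.sum_eq_single τ]
  · by_cases h : υ = τ * σ
    · subst h; simp [monomial]
    · have h' : τ⁻¹ * υ ≠ σ := fun h' => h (by rw [← h']; group)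
      simp [monomial, h, h']
  · intro b _ hb; simp [monomial, hb]
  · simp

noncomputable instance : Ring (CrossedProduct Φ) where
  __ := instAddCommGroup Φ
  left_distrib x y z := by
    ext υ; simp [mul_apply, mul_add, Finset.sum_add_distrib]
  right_distrib x y z := by
    ext υ; simp [mul_apply, mul_add, add_mul, Finset.sum_add_distrib]
  zero_mul x := by ext υ; simp [mul_apply]
  mul_zero x := by ext υ; simp [mul_apply]
  one_mul x := by
    ext υ
    rw [mul_apply, Finset.sum_eq_single υ]
    · simp [one_def, monomial, factor_one_left Φ υ]
    · intro τ _ h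
      have h' : τ⁻¹ * υ ≠ 1 := fun h' => h (inv_mul_eq_one.mp h')
      simp [one_def, monomial, h']
    · simp
  mul_one x := by
    ext υ
    rw [mul_apply, Finset.sum_eq_single 1]
    · simp only [inv_one, one_mul, one_def, monomial, if_true, AlgEquiv.one_apply,
        factor_one_right Φ υ]
      field_simp
    · intro τ _ h
      simp [one_def, monomial, h]
    · simp
  mul_assoc x y z := by
    ext υ
    simp only [mul_apply, map_sum, map_mul, Finset.mul_sum, Finset.sum_mul]
    rw [Finset.sum_comm (s := (Finset.univ : Finset (E ≃ₐ[F] E)))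
      (f := fun κ τ => (Φ.toFun (κ⁻¹ * υ) κ : E) * κ (x (κ⁻¹ * υ)) *
        ((Φ.toFun (τ⁻¹ * κ) τ : E) * τ (y (τ⁻¹ * κ)) * z τ))]
    refine Finset.sum_congr rfl fun τ _ => ?_
    refine Fintype.sum_equiv (Equiv.mulLeft τ) _ _ fun ρ => ?_
    have h := Φ.cocycle (ρ⁻¹ * (τ⁻¹ * υ)) ρ τ
    simp only [mul_inv_cancel_left] at h
    simp only [Equiv.coe_mulLeft, mul_inv_rev, inv_mul_cancel_left, AlgEquiv.mul_apply, mul_assoc]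
    linear_combination (τ (ρ (x (ρ⁻¹ * (τ⁻¹ * υ)))) * τ (y ρ) * z τ) * h

noncomputable instance : Algebra F (CrossedProduct Φ) :=
  Algebra.ofModule
    (fun r x y => by
      ext υ
      simp only [mul_apply, smul_apply, map_smul]
      simp only [Algebra.smul_def, Finset.mul_sum]
      exact Finset.sum_congr rfl fun τ _ => by ring)
    (fun r x y => by
      ext υ
      simp only [mul_apply, smul_apply]
      simp only [Algebra.smul_def, Finset.mul_sum]
      exact Finset.sum_congr rfl fun τ _ => by ring)

/-- The subspace `B` spanned by the elements `u_ρ e` with `ρ` an involution (`ρ² = id ≠ ρ`). -/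
noncomputable def involutionSpace : Submodule F (CrossedProduct Φ) :=
  Submodule.span F {x | ∃ (ρ : E ≃ₐ[F] E) (e : E), ρ * ρ = 1 ∧ ρ ≠ 1 ∧ x = monomial Φ ρ e}

end CrossedProduct

/-! ### Uniqueness of the reduced polynomial -/

/-! The polar form of `t₂` is `t₁(x) t₁(y) - t₁(xy)`, and `t₁` sees only the coordinate at `1`.
Hence `u_σ E` and `u_τ E` are orthogonal unless `τ = σ⁻¹` (for `σ = τ = 1` this pairs `E` with
itself). So `A` is the orthogonal sum of `E`, of `B`, and of the planes `u_σ E ⊕ u_{σ⁻¹} E` over the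
pairs `{σ, σ⁻¹}` with `σ² ≠ 1`. On `E` the form `t₂` is `T₂` (`reducedSecondForm_coeffEmbedding`).
Choosing one `σ` from each pair gives two subspaces on which `t₂` vanishes, paired perfectly by
`-t₁(xy)` because the trace form of `E/F` is nondegenerate; their sum is hyperbolic
(`equivalent_hyperbolicSpace`). In odd degree the condition `t₁ = 0` restricts only the summand `E`,
and `B = 0` as `G` has no involution. Characteristic `2` enters through the nonsingularity of
`T_{E/F}`.

All this is computed in the left regular representation `regularRep` by `n × n` matrices over `E`.
It becomes an isomorphism over every extension of `E`, so its characteristic polynomial is the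
reduced one once that is known to lie in `F[x]`. Both this descent and uniqueness rest on one fact:
the `n`-th power of the reduced polynomial is the characteristic polynomial of left multiplication
on `A`, and monic `n`-th roots are unique. -/

open Polynomial in
theorem Polynomial.Monic.eq_of_pow_eq {F : Type u} [Field F] {p q : F[X]} (hp : p.Monic)
    (hq : q.Monic) {n : ℕ} (hn : n ≠ 0) (h : p ^ n = q ^ n) : p = q :=
  eq_of_monic_of_associated hp hq <| associated_of_dvd_dvd
    ((UniqueFactorizationMonoid.pow_dvd_pow_iff_dvd hn).mp h.dvd)
    ((UniqueFactorizationMonoid.pow_dvd_pow_iff_dvd hn).mp h.symm.dvd)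

theorem Matrix.charpoly_blockDiagonal_const {K : Type u} [Field K] {n o : Type*} [Fintype n]
    [DecidableEq n] [Fintype o] [DecidableEq o] (N : Matrix n n K) :
    (Matrix.blockDiagonal fun _ : o => N).charpoly = N.charpoly ^ Fintype.card o := by
  have h : (Matrix.blockDiagonal fun _ : o => N).charmatrix =
      Matrix.blockDiagonal fun _ : o => N.charmatrix := by
    ext ⟨i, k⟩ ⟨j, l⟩
    by_cases hk : k = l <;> by_cases hi : i = j <;>
      simp [Matrix.blockDiagonal_apply, hk, hi]
  rw [Matrix.charpoly, h, Matrix.det_blockDiagonal]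
  simp [Matrix.charpoly]

/-- Left multiplication acts on each column separately, so in the basis of matrix units it is one
copy of `N` per column. -/
theorem Matrix.charpoly_lmul {K : Type u} [Field K] {n : Type*} [Fintype n] [DecidableEq n]
    (N : Matrix n n K) :
    (Algebra.lmul K (Matrix n n K) N).charpoly = N.charpoly ^ Fintype.card n := by
  rw [← Matrix.charpoly_blockDiagonal_const (o := n),
    ← LinearMap.charpoly_toMatrix _ (Matrix.stdBasis K n n)]
  congr 1
  ext ⟨i, k⟩ ⟨j, l⟩
  have hrepr (M : Matrix n n K) : (Matrix.stdBasis K n n).repr M (i, k) = M i k := by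
    simp [Matrix.stdBasis]
  rw [LinearMap.toMatrix_apply, hrepr, Matrix.stdBasis_eq_single, Matrix.blockDiagonal_apply]
  by_cases h : k = l
  · subst h; simp
  · simp [h]

section Reduced

variable {F : Type u} {A : Type v} [Field F] [Ring A] [Algebra F A]

theorem algDegree_eq_of_algEquiv {K : Type w} [Field K] [Algebra F K] {n : ℕ}
    (ψ : K ⊗[F] A ≃ₐ[K] Matrix (Fin n) (Fin n) K) : algDegree F A = n := by
  have h := ψ.toLinearEquiv.finrank_eq
  rw [Module.finrank_baseChange, Module.finrank_matrix] at h
  simp [algDegree, h, Nat.sqrt_eq]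

theorem IsReducedCharpoly.monic {a : A} {p : F[X]} (h : IsReducedCharpoly F a p) : p.Monic := by
  obtain ⟨K, _, _, n, ψ, h⟩ := h
  exact Polynomial.monic_of_injective (algebraMap F K).injective (h ▸ Matrix.charpoly_monic _)

/-- The right side mentions no splitting field, which is what makes the reduced polynomial
independent of the choice of one. -/
theorem IsReducedCharpoly.pow_algDegree [FiniteDimensional F A] {a : A} {p : F[X]}
    (h : IsReducedCharpoly F a p) : p ^ algDegree F A = (Algebra.lmul F A a).charpoly := by
  obtain ⟨K, _, _, n, ψ, h⟩ := h
  apply Polynomial.map_injective _ (algebraMap F K).injective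
  rw [algDegree_eq_of_algEquiv ψ, Polynomial.map_pow, h, ← LinearMap.charpoly_baseChange,
    Algebra.baseChange_lmul, ← LinearEquiv.charpoly_conj ψ.toLinearEquiv]
  refine (congrArg _ (Fintype.card_fin n).symm).trans ((Matrix.charpoly_lmul _).symm.trans ?_)
  congr 1
  ext1 x
  simp [LinearEquiv.conj_apply]

theorem algDegree_ne_zero [FiniteDimensional F A] [Nontrivial A] : algDegree F A ≠ 0 := by
  have : 0 < Module.finrank F A := Module.finrank_pos
  exact (Nat.sqrt_pos.mpr this).ne'

theorem IsReducedCharpoly.unique [FiniteDimensional F A] [Nontrivial A] {a : A} {p q : F[X]}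
    (hp : IsReducedCharpoly F a p) (hq : IsReducedCharpoly F a q) : p = q :=
  hp.monic.eq_of_pow_eq hq.monic (algDegree_ne_zero (F := F) (A := A))
    (hp.pow_algDegree.trans hq.pow_algDegree.symm)

theorem IsReducedCharpoly.reducedCharpoly_eq [FiniteDimensional F A] [Nontrivial A] {a : A}
    {p : F[X]} (hp : IsReducedCharpoly F a p) : reducedCharpoly F a = p := by
  have h : ∃ p, IsReducedCharpoly F a p := ⟨p, hp⟩
  rw [reducedCharpoly, dif_pos h]
  exact h.choose_spec.unique hp

end Reduced

/-! ### The splitting representation of a crossed product -/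

namespace CrossedProduct

open scoped Classical

variable {F : Type u} {E : Type v} [Field F] [Field E] [Algebra F E] (Φ : FactorSet F E)
  [FiniteDimensional F E]

theorem finrank_eq_sq [IsGalois F E] : Module.finrank F (CrossedProduct Φ) =
    Module.finrank F E * Module.finrank F E := by
  have h : Module.finrank F (CrossedProduct Φ) = Module.finrank F ((E ≃ₐ[F] E) → E) := rfl
  rw [h, Module.finrank_pi_fintype, Finset.sum_const, Finset.card_univ, ← Nat.card_eq_fintype_card,
    IsGalois.card_aut_eq_finrank, smul_eq_mul]

instance : FiniteDimensional F (CrossedProduct Φ) :=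
  inferInstanceAs (FiniteDimensional F ((E ≃ₐ[F] E) → E))

instance : Nontrivial (CrossedProduct Φ) :=
  inferInstanceAs (Nontrivial ((E ≃ₐ[F] E) → E))

variable {Φ}

/-- The matrix of left multiplication by `x` on the right `E`-space `⨁ u_σ E`. -/
noncomputable def regularMatrix (x : CrossedProduct Φ) : Matrix (E ≃ₐ[F] E) (E ≃ₐ[F] E) E :=
  fun υ τ => (Φ.toFun (τ⁻¹ * υ) τ : E) * τ (x (τ⁻¹ * υ))

variable (Φ) in
/-- The left regular representation of the crossed product over `E`. -/
noncomputable def regularRep : CrossedProduct Φ →ₐ[F] Matrix (E ≃ₐ[F] E) (E ≃ₐ[F] E) E :=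
  AlgHom.ofLinearMap
    { toFun := regularMatrix
      map_add' x y := by ext υ τ; simp [regularMatrix, mul_add]
      map_smul' r x := by ext υ τ; simp [regularMatrix] }
    -- By definition of the product, `x * y` is `regularMatrix x` applied to the vector `y`; the
    -- laws of a representation are therefore the unit and associativity laws of the ring.
    (Matrix.mulVec_injective <| funext fun y => by
      rw [Matrix.one_mulVec]
      exact one_mul (M := CrossedProduct Φ) y)
    (fun x y => Matrix.mulVec_injective <| funext fun z => by
      exact (mul_assoc x y z).trans (Matrix.mulVec_mulVec z (regularMatrix x) (regularMatrix y)))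

theorem regularRep_apply (x : CrossedProduct Φ) (υ τ : E ≃ₐ[F] E) :
    regularRep Φ x υ τ = (Φ.toFun (τ⁻¹ * υ) τ : E) * τ (x (τ⁻¹ * υ)) := rfl

/-- Dedekind's independence of the distinct embeddings `ι ∘ τ`. -/
theorem linearIndependent_comp_algEquiv {K : Type w} [Field K] [Algebra F K] (ι : E →ₐ[F] K)
    (w : (E ≃ₐ[F] E) → K) (h : ∀ c, ∑ τ, w τ * ι (τ c) = 0) : w = 0 := by
  have hli : LinearIndependent K
      fun τ : E ≃ₐ[F] E => (ι.comp (τ : E →ₐ[F] E)).toLinearMap := by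
    refine (linearIndependent_algHom_toLinearMap F E K).comp
      (fun τ : E ≃ₐ[F] E => ι.comp (τ : E →ₐ[F] E)) fun σ τ h => ?_
    ext c
    exact ι.injective (DFunLike.congr_fun h c)
  funext τ
  refine Fintype.linearIndependent_iff.mp hli w ?_ τ
  ext c
  simpa using h c

variable (Φ) in
/-- The representation of the crossed product over an extension `K` of `E`. -/
noncomputable def extendedRep {K : Type w} [Field K] [Algebra F K] (ι : E →ₐ[F] K) :
    K ⊗[F] CrossedProduct Φ →ₐ[K] Matrix (E ≃ₐ[F] E) (E ≃ₐ[F] E) K :=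
  Algebra.TensorProduct.lift (Algebra.ofId K _) (ι.mapMatrix.comp (regularRep Φ))
    fun k _ => by
      rw [Algebra.ofId_apply]
      exact Algebra.commute_algebraMap_left k _

theorem extendedRep_tmul {K : Type w} [Field K] [Algebra F K] (ι : E →ₐ[F] K) (k : K)
    (x : CrossedProduct Φ) :
    extendedRep Φ ι (k ⊗ₜ x) = k • (regularRep Φ x).map ι := by
  rw [extendedRep, Algebra.TensorProduct.lift_tmul, Algebra.ofId_apply, Algebra.smul_def]
  rfl

/-- Otherwise a nonzero functional `f` kills the image. The image of `u_σ c` is `∑ ι(Φ(σ,τ) τ(c))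
E_{τσ,τ}`; letting `c` vary, Dedekind independence makes `f` vanish on each matrix unit. -/
theorem extendedRep_surjective {K : Type w} [Field K] [Algebra F K] (ι : E →ₐ[F] K) :
    Function.Surjective (extendedRep Φ ι) := by
  have : LinearMap.range (extendedRep Φ ι).toLinearMap = ⊤ := by
    by_contra hne
    obtain ⟨f, hf, hle⟩ := Submodule.exists_le_ker_of_lt_top _ (lt_top_iff_ne_top.mpr hne)
    refine hf ?_
    have key (σ : E ≃ₐ[F] E) : (fun τ => f (Matrix.single (τ * σ) τ 1) * ι (Φ.toFun σ τ)) = 0 := by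
      refine linearIndependent_comp_algEquiv ι _ fun c => ?_
      have h0 : f (extendedRep Φ ι (1 ⊗ₜ monomial Φ σ c)) = 0 := hle ⟨1 ⊗ₜ monomial Φ σ c, rfl⟩
      have hM : extendedRep Φ ι (1 ⊗ₜ monomial Φ σ c) =
          ∑ τ, (ι (Φ.toFun σ τ) * ι (τ c)) • Matrix.single (τ * σ) τ (1 : K) := by
        rw [extendedRep_tmul, one_smul]
        ext υ τ
        rw [Matrix.sum_apply, Finset.sum_eq_single τ]
        · by_cases h : τ⁻¹ * υ = σ
          · have h' : υ = τ * σ := by rw [← h]; group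
            subst h'
            simp [regularRep_apply, monomial]
          · have h' : τ * σ ≠ υ := fun h' => h (by rw [← h']; group)
            simp [regularRep_apply, monomial, h, h', Matrix.single]
        · intro κ _ hκ
          simp [Matrix.single, hκ]
        · simp
      rw [hM, map_sum] at h0
      rw [← h0]
      exact Finset.sum_congr rfl fun τ _ => by rw [map_smul, smul_eq_mul]; ring
    refine Matrix.ext_linearMap _ fun υ τ => ?_
    ext
    have h := congrFun (key (τ⁻¹ * υ)) τ
    simp only [mul_inv_cancel_left, Pi.zero_apply, mul_eq_zero] at h
    have hne : ι (Φ.toFun (τ⁻¹ * υ) τ) ≠ 0 := by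
      rw [map_ne_zero]; exact Units.ne_zero _
    simpa using h.resolve_right hne
  exact LinearMap.range_eq_top.mp this

variable [IsGalois F E]

variable (Φ) in
/-- The crossed product is split by every extension of `E`. -/
noncomputable def splitting {K : Type w} [Field K] [Algebra F K] (ι : E →ₐ[F] K) :
    K ⊗[F] CrossedProduct Φ ≃ₐ[K] Matrix (E ≃ₐ[F] E) (E ≃ₐ[F] E) K :=
  AlgEquiv.ofBijective (extendedRep Φ ι) <| by
    have hr : Module.finrank K (K ⊗[F] CrossedProduct Φ) =
        Module.finrank K (Matrix (E ≃ₐ[F] E) (E ≃ₐ[F] E) K) := by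
      rw [Module.finrank_baseChange, finrank_eq_sq, Module.finrank_matrix, Module.finrank_self,
        ← Nat.card_eq_fintype_card, IsGalois.card_aut_eq_finrank, mul_one]
    have hs : Function.Surjective (extendedRep Φ ι).toLinearMap := extendedRep_surjective ι
    exact ⟨(LinearMap.injective_iff_surjective_of_finrank_eq_finrank hr).mpr hs, hs⟩

theorem card_eq_finrank : Fintype.card (E ≃ₐ[F] E) = Module.finrank F E := by
  rw [← Nat.card_eq_fintype_card, IsGalois.card_aut_eq_finrank]

theorem algDegree_eq_finrank : algDegree F (CrossedProduct Φ) = Module.finrank F E := by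
  rw [algDegree, finrank_eq_sq, Nat.sqrt_eq]

theorem charpoly_regularRep_pow (x : CrossedProduct Φ) :
    (regularRep Φ x).charpoly ^ Module.finrank F E =
      (Algebra.lmul F (CrossedProduct Φ) x).charpoly.map (algebraMap F E) := by
  let ψ := splitting Φ (AlgHom.id F E)
  have h : regularRep Φ x = ψ (1 ⊗ₜ x) := by
    change _ = extendedRep Φ _ (1 ⊗ₜ x)
    rw [extendedRep_tmul]; simp
  rw [← LinearMap.charpoly_baseChange, Algebra.baseChange_lmul,
    ← LinearEquiv.charpoly_conj ψ.toLinearEquiv, ← card_eq_finrank, ← Matrix.charpoly_lmul, h]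
  congr 1
  ext1 x
  simp [LinearEquiv.conj_apply]

open Polynomial in
-- A Galois conjugate of this polynomial has the same `n`-th power, which has coefficients in `F`;
-- both being monic, they agree, so every coefficient is fixed by `G`.
theorem exists_map_eq_charpoly_regularRep (x : CrossedProduct Φ) :
    ∃ p : F[X], p.map (algebraMap F E) = (regularRep Φ x).charpoly := by
  refine (Polynomial.mem_lifts _).mp <| (Polynomial.lifts_iff_coeff_lifts _).mpr fun k => ?_
  rw [IsGalois.mem_range_algebraMap_iff_fixed]
  intro σ
  have h : (regularRep Φ x).charpoly.map (σ : E →+* E) = (regularRep Φ x).charpoly := by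
    refine ((Matrix.charpoly_monic _).map _).eq_of_pow_eq (Matrix.charpoly_monic _)
      (Module.finrank_pos (R := F) (M := E)).ne' ?_
    rw [← Polynomial.map_pow, charpoly_regularRep_pow, Polynomial.map_map]
    congr 1
    ext r
    simp
  conv_rhs => rw [← h]
  simp

theorem exists_isReducedCharpoly (x : CrossedProduct Φ) :
    ∃ p : F[X], IsReducedCharpoly F x p ∧ p.map (algebraMap F E) = (regularRep Φ x).charpoly := by
  obtain ⟨p, hp⟩ := exists_map_eq_charpoly_regularRep x
  -- `IsReducedCharpoly` asks for a splitting field in the universe of `F`, where `E` need not live;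
  -- the algebraic closure of `F` serves instead.
  let ι : E →ₐ[F] AlgebraicClosure F := IsAlgClosed.lift
  let e : (E ≃ₐ[F] E) ≃ Fin (Fintype.card (E ≃ₐ[F] E)) := Fintype.equivFin _
  refine ⟨p, ⟨AlgebraicClosure F, inferInstance, inferInstance, _,
    (splitting Φ ι).trans (Matrix.reindexAlgEquiv _ _ e), ?_⟩, hp⟩
  rw [AlgEquiv.trans_apply, Matrix.coe_reindexAlgEquiv, Matrix.charpoly_reindex]
  change _ = (extendedRep Φ ι (1 ⊗ₜ x)).charpoly
  rw [extendedRep_tmul, one_smul]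
  refine .trans ?_ (Matrix.charpoly_map (regularRep Φ x) (ι : E →+* AlgebraicClosure F)).symm
  rw [← hp, Polynomial.map_map, AlgHom.comp_algebraMap]

theorem map_reducedCharpoly (x : CrossedProduct Φ) :
    (reducedCharpoly F x).map (algebraMap F E) = (regularRep Φ x).charpoly := by
  obtain ⟨p, hp, h⟩ := exists_isReducedCharpoly x
  rwa [hp.reducedCharpoly_eq]

theorem existsUnique_isReducedCharpoly (x : CrossedProduct Φ) :
    ∃! p : F[X], IsReducedCharpoly F x p :=
  let ⟨p, hp, _⟩ := exists_isReducedCharpoly x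
  ⟨p, hp, fun _ hq => hq.unique hp⟩

end CrossedProduct

/-! ### The second coefficient of a characteristic polynomial -/

namespace Matrix

variable {R : Type u} [CommRing R] {n : Type v}

theorem exists_det_submatrix_of_card_eq_two [DecidableEq n] {s : Finset n} (hs : s.card = 2) :
    ∃ i j, i ≠ j ∧ s = {i, j} ∧ ∀ M : Matrix n n R,
      (M.submatrix (Subtype.val : s → n) (Subtype.val : s → n)).det =
        M i i * M j j - M i j * M j i := by
  have hc : Fintype.card s = 2 := by simpa using hs
  let e : Fin 2 ≃ s := (Fintype.equivFinOfCardEq hc).symm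
  have hne : (e 0 : n) ≠ e 1 := fun h => by simpa using e.injective (Subtype.ext h)
  refine ⟨e 0, e 1, hne, ?_, fun M => ?_⟩
  · refine (Finset.eq_of_subset_of_card_le ?_ (by rw [hs, Finset.card_pair hne])).symm
    intro x hx
    rcases Finset.mem_insert.mp hx with rfl | hx
    · exact (e 0).2
    · rw [Finset.mem_singleton.mp hx]; exact (e 1).2
  · rw [← det_submatrix_equiv_self e, det_fin_two]
    simp

variable [Fintype n] [DecidableEq n]

/-- The sum of the principal `2 × 2` minors. -/
noncomputable def secondMinorSum (M : Matrix n n R) : R :=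
  ∑ s ∈ (Finset.univ : Finset n).powersetCard 2,
    (M.submatrix (Subtype.val : s → n) (Subtype.val : s → n)).det

theorem sum_powersetCard_two_offDiag (t : n × n → R) :
    ∑ s ∈ (Finset.univ : Finset n).powersetCard 2, ∑ p ∈ s.offDiag, t p =
      ∑ p ∈ (Finset.univ : Finset n).offDiag, t p := by
  rw [← Finset.sum_fiberwise_of_maps_to (s := (Finset.univ : Finset n).offDiag)
    (t := (Finset.univ : Finset n).powersetCard 2) (g := fun p => {p.1, p.2})]
  · refine Finset.sum_congr rfl fun s hs => Finset.sum_congr ?_ fun _ _ => rfl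
    have hs : s.card = 2 := (Finset.mem_powersetCard.mp hs).2
    ext ⟨i, j⟩
    simp only [Finset.mem_offDiag, Finset.mem_filter, Finset.mem_univ, true_and]
    constructor
    · rintro ⟨hi, hj, hij⟩
      refine ⟨hij, Finset.eq_of_subset_of_card_le ?_ (by rw [hs, Finset.card_pair hij])⟩
      intro x hx
      rcases Finset.mem_insert.mp hx with rfl | hx
      · exact hi
      · rwa [Finset.mem_singleton.mp hx]
    · rintro ⟨hij, rfl⟩
      simp [hij]
  · rintro ⟨i, j⟩ h
    have hij : i ≠ j := by simpa using h
    simp [Finset.mem_powersetCard, Finset.card_pair hij]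

/-- The source of the polar form of `t₂`. With `t(i,j) = M i i * N j j - M i j * N j i`, the mixed
part of the minor on `{i, j}` is `t(i,j) + t(j,i)`, and `t(i,i) = 0`, so the total is the sum of `t`
over all ordered pairs. -/
theorem secondMinorSum_add (M N : Matrix n n R) :
    (M + N).secondMinorSum =
      M.secondMinorSum + N.secondMinorSum + (M.trace * N.trace - (M * N).trace) := by
  let t : n × n → R := fun p => M p.1 p.1 * N p.2 p.2 - M p.1 p.2 * N p.2 p.1
  have h1 : M.trace * N.trace - (M * N).trace = ∑ p, t p := by
    simp only [t, Fintype.sum_prod_type, Finset.sum_sub_distrib, trace, diag_apply, mul_apply,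
      Finset.sum_mul_sum]
  have h2 : ∑ p, t p = ∑ p ∈ (Finset.univ : Finset n).offDiag, t p := by
    refine (Finset.sum_subset (Finset.subset_univ _) ?_).symm
    rintro ⟨i, j⟩ - hij
    obtain rfl : i = j := by simpa using hij
    simp only [t]; ring
  rw [h1, h2, ← sum_powersetCard_two_offDiag, secondMinorSum, secondMinorSum, secondMinorSum,
    ← Finset.sum_add_distrib, ← Finset.sum_add_distrib]
  refine Finset.sum_congr rfl fun s hs => ?_
  obtain ⟨i, j, hij, rfl, h⟩ :=
    exists_det_submatrix_of_card_eq_two (R := R) (Finset.mem_powersetCard.mp hs).2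
  have ho : ({i, j} : Finset n).offDiag = {(i, j), (j, i)} := by
    ext ⟨a, b⟩
    simp only [Finset.mem_offDiag, Finset.mem_insert, Finset.mem_singleton, Prod.mk.injEq]
    grind
  rw [h, h, h, ho, Finset.sum_pair (by simp [hij])]
  simp only [t, add_apply]
  ring

theorem secondMinorSum_smul (r : R) (M : Matrix n n R) :
    (r • M).secondMinorSum = r * r * M.secondMinorSum := by
  rw [secondMinorSum, secondMinorSum, Finset.mul_sum]
  refine Finset.sum_congr rfl fun s hs => ?_
  obtain ⟨i, j, hij, rfl, h⟩ :=
    exists_det_submatrix_of_card_eq_two (R := R) (Finset.mem_powersetCard.mp hs).2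
  rw [h, h]
  simp only [smul_apply, smul_eq_mul]
  ring

theorem secondMinorSum_eq_zero {M : Matrix n n R} (hd : ∀ i, M i i = 0)
    (h : ∀ i j, i ≠ j → M i j * M j i = 0) : M.secondMinorSum = 0 := by
  refine Finset.sum_eq_zero fun s hs => ?_
  obtain ⟨i, j, hij, rfl, hM⟩ :=
    exists_det_submatrix_of_card_eq_two (R := R) (Finset.mem_powersetCard.mp hs).2
  rw [hM, hd, h i j hij]
  simp

end Matrix

theorem signedCoeff_two_charpoly {K : Type u} [Field K] {n : Type v} [Fintype n] [DecidableEq n]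
    (M : Matrix n n K) : signedCoeff (Fintype.card n) 2 M.charpoly = M.secondMinorSum := by
  rw [signedCoeff]
  split_ifs with h
  · rw [Matrix.charpoly_coeff_eq_sum_minors M 2 h, Matrix.secondMinorSum]
    ring
  · rw [Matrix.secondMinorSum, Finset.powersetCard_eq_empty.mpr (by simpa using h),
      Finset.sum_empty]

theorem signedCoeff_one_charpoly {K : Type u} [Field K] {n : Type v} [Fintype n] [DecidableEq n]
    [Nonempty n] (M : Matrix n n K) : signedCoeff (Fintype.card n) 1 M.charpoly = M.trace := by
  rw [signedCoeff, if_pos (Nat.one_le_iff_ne_zero.mpr Fintype.card_ne_zero), Matrix.trace_eq_neg_charpoly_coeff]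
  ring

theorem map_signedCoeff {K : Type u} {L : Type v} [Field K] [Field L] (f : K →+* L) (n k : ℕ)
    (p : K[X]) : f (signedCoeff n k p) = signedCoeff n k (p.map f) := by
  unfold signedCoeff
  split_ifs <;> simp

/-! ### The forms `t₁` and `t₂` of a crossed product -/

-- The matrix `V = (τ(b_ρ))` intertwines multiplication by `e` in the basis `b` with the diagonal
-- matrix of conjugates; it is invertible by Dedekind independence.
open scoped Classical in
theorem Algebra.charpoly_lmul_map_eq_prod {F : Type u} {E : Type v} [Field F] [Field E]
    [Algebra F E] [FiniteDimensional F E] [IsGalois F E] (e : E) :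
    (Algebra.lmul F E e).charpoly.map (algebraMap F E) =
      (Matrix.diagonal fun τ : E ≃ₐ[F] E => τ e).charpoly := by
  let b : Module.Basis (E ≃ₐ[F] E) F E := (Module.finBasis F E).reindex
    (Fintype.equivOfCardEq (by rw [Fintype.card_fin, CrossedProduct.card_eq_finrank]))
  let V : Matrix (E ≃ₐ[F] E) (E ≃ₐ[F] E) E := fun τ ρ => τ (b ρ)
  let L := (Algebra.leftMulMatrix b e).map (algebraMap F E)
  have hV : IsUnit V := by
    rw [← Matrix.isUnit_transpose, ← Matrix.linearIndependent_cols_iff_isUnit,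
      Fintype.linearIndependent_iff]
    intro w hw
    refine congrFun (CrossedProduct.linearIndependent_comp_algEquiv (AlgHom.id F E) w fun c => ?_)
    have hb (ρ : E ≃ₐ[F] E) : ∑ τ, w τ * τ (b ρ) = 0 := by
      simpa [Matrix.col] using congrFun hw ρ
    rw [← b.sum_repr c]
    simp only [map_sum, map_smul, Finset.mul_sum, mul_smul_comm, AlgHom.id_apply]
    rw [Finset.sum_comm]
    exact Finset.sum_eq_zero fun ρ _ => by rw [← Finset.smul_sum, hb, smul_zero]
  have hVL : Matrix.diagonal (fun τ : E ≃ₐ[F] E => τ e) * V = V * L := by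
    ext τ ρ
    rw [Matrix.diagonal_mul, Matrix.mul_apply]
    have h : e * b ρ = ∑ κ, Algebra.leftMulMatrix b e κ ρ • b κ := by
      rw [← b.sum_repr (e * b ρ)]
      simp [Algebra.leftMulMatrix_eq_repr_mul]
    change τ e * τ (b ρ) = _
    rw [← map_mul, h, map_sum]
    refine Finset.sum_congr rfl fun κ _ => ?_
    simp [V, L, Algebra.smul_def, mul_comm]
  have h1 : (Algebra.lmul F E e).charpoly = (Algebra.leftMulMatrix b e).charpoly := by
    rw [← LinearMap.charpoly_toMatrix _ b]; rfl
  have h2 := Matrix.charpoly_units_conj' hV.unit (Matrix.diagonal fun τ : E ≃ₐ[F] E => τ e)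
  rw [h1, ← Matrix.charpoly_map, ← h2]
  congr 1
  rw [mul_assoc, IsUnit.unit_spec, hVL, ← mul_assoc,
    Matrix.nonsing_inv_mul _ ((Matrix.isUnit_iff_isUnit_det _).mp hV), one_mul]

namespace CrossedProduct

open scoped Classical

variable {F : Type u} {E : Type v} [Field F] [Field E] [Algebra F E] {Φ : FactorSet F E}
  [FiniteDimensional F E]

variable (Φ) in
/-- The linear map `∑ u_σ x_σ ↦ tr (Φ(1, 1) x_1)`. -/
noncomputable def traceMap : CrossedProduct Φ →ₗ[F] F :=
  Algebra.trace F E ∘ₗ LinearMap.mulLeft F (Φ.toFun 1 1 : E) ∘ₗ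
    (LinearMap.proj 1 : ((E ≃ₐ[F] E) → E) →ₗ[F] E)

theorem traceMap_apply (x : CrossedProduct Φ) :
    traceMap Φ x = Algebra.trace F E (Φ.toFun 1 1 * x 1) := rfl

variable (Φ) in
/-- The embedding of `E` as the subalgebra `u_1 E`. -/
noncomputable def coeffEmbedding : E →ₗ[F] CrossedProduct Φ where
  toFun e := monomial Φ 1 ((Φ.toFun 1 1 : E)⁻¹ * e)
  map_add' x y := by
    ext σ; by_cases h : σ = 1 <;> simp [monomial, h, mul_add]
  map_smul' r x := by
    ext σ; by_cases h : σ = 1 <;> simp [monomial, h]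

theorem coeffEmbedding_apply_one (e : E) : coeffEmbedding Φ e 1 = (Φ.toFun 1 1 : E)⁻¹ * e := by
  simp [coeffEmbedding, monomial]

theorem coeffEmbedding_apply_of_ne (e : E) {σ : E ≃ₐ[F] E} (h : σ ≠ 1) :
    coeffEmbedding Φ e σ = 0 := by
  simp [coeffEmbedding, monomial, h]

variable [IsGalois F E]

theorem algebraMap_traceMap (x : CrossedProduct Φ) :
    algebraMap F E (traceMap Φ x) = (regularRep Φ x).trace := by
  rw [traceMap_apply, trace_eq_sum_automorphisms]
  refine Finset.sum_congr rfl fun τ _ => ?_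
  rw [Matrix.diag_apply, regularRep_apply, inv_mul_cancel, factor_one_left Φ τ, map_mul]

theorem reducedCoeff_one (x : CrossedProduct Φ) :
    reducedCoeff F (CrossedProduct Φ) 1 x = traceMap Φ x := by
  apply (algebraMap F E).injective
  rw [algebraMap_traceMap, reducedCoeff, map_signedCoeff, map_reducedCharpoly,
    algDegree_eq_finrank, ← card_eq_finrank, signedCoeff_one_charpoly]

theorem algebraMap_reducedCoeff_two (x : CrossedProduct Φ) :
    algebraMap F E (reducedCoeff F (CrossedProduct Φ) 2 x) =
      (regularRep Φ x).secondMinorSum := by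
  rw [reducedCoeff, map_signedCoeff, map_reducedCharpoly,
    algDegree_eq_finrank, ← card_eq_finrank, signedCoeff_two_charpoly]

theorem reducedCoeff_two_add (x y : CrossedProduct Φ) :
    reducedCoeff F (CrossedProduct Φ) 2 (x + y) =
      reducedCoeff F (CrossedProduct Φ) 2 x + reducedCoeff F (CrossedProduct Φ) 2 y +
        (traceMap Φ x * traceMap Φ y - traceMap Φ (x * y)) := by
  apply (algebraMap F E).injective
  simp only [map_add, map_sub, map_mul, algebraMap_reducedCoeff_two, algebraMap_traceMap,
    Matrix.secondMinorSum_add]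

variable (Φ) in
/-- The polar form of `t₂`. -/
noncomputable def polarMap : LinearMap.BilinMap F (CrossedProduct Φ) F :=
  LinearMap.mk₂ F (fun x y => traceMap Φ x * traceMap Φ y - traceMap Φ (x * y))
    (fun x y z => by simp only [map_add, add_mul]; ring)
    (fun r x y => by simp only [map_smul, smul_mul_assoc, smul_sub])
    (fun x y z => by simp only [map_add, mul_add]; ring)
    (fun r x y => by simp only [map_smul, mul_smul_comm, smul_sub])

theorem exists_reducedSecondForm :
    ∃ Q : QuadraticForm F (CrossedProduct Φ), ∀ x, Q x = reducedCoeff F (CrossedProduct Φ) 2 x :=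
  ⟨{ toFun := reducedCoeff F (CrossedProduct Φ) 2
     toFun_smul := fun r x => by
      apply (algebraMap F E).injective
      rw [smul_eq_mul, map_mul, map_mul, algebraMap_reducedCoeff_two, algebraMap_reducedCoeff_two,
        ← Matrix.secondMinorSum_smul, map_smul, algebraMap_smul]
     exists_companion' := ⟨polarMap Φ, fun x y => reducedCoeff_two_add x y⟩ }, fun _ => rfl⟩

variable (Φ) in
theorem hasReducedForms : HasReducedForms F (CrossedProduct Φ) where
  existsUnique_charpoly := existsUnique_isReducedCharpoly
  trace_apply := by
    have h : ∃ f : CrossedProduct Φ →ₗ[F] F, ∀ a, f a = reducedCoeff F (CrossedProduct Φ) 1 a :=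
      ⟨traceMap Φ, fun a => (reducedCoeff_one a).symm⟩
    rw [reducedTrace, dif_pos h]
    exact h.choose_spec
  second_apply := by
    have h := exists_reducedSecondForm (Φ := Φ)
    rw [reducedSecondForm, dif_pos h]
    exact h.choose_spec

theorem reducedTrace_eq : reducedTrace F (CrossedProduct Φ) = traceMap Φ :=
  LinearMap.ext fun x => ((hasReducedForms Φ).trace_apply x).trans (reducedCoeff_one x)

theorem algebraMap_reducedSecondForm (x : CrossedProduct Φ) :
    algebraMap F E (reducedSecondForm F (CrossedProduct Φ) x) =
      (regularRep Φ x).secondMinorSum := by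
  rw [(hasReducedForms Φ).second_apply, algebraMap_reducedCoeff_two]

theorem reducedSecondForm_add (x y : CrossedProduct Φ) :
    reducedSecondForm F (CrossedProduct Φ) (x + y) =
      reducedSecondForm F (CrossedProduct Φ) x + reducedSecondForm F (CrossedProduct Φ) y +
        (traceMap Φ x * traceMap Φ y - traceMap Φ (x * y)) := by
  simp only [(hasReducedForms Φ).second_apply, reducedCoeff_two_add]

/-- In the regular representation the image of `e` is the diagonal matrix of its conjugates `τ e`,
with the same characteristic polynomial as multiplication by `e` on `E`. -/
theorem reducedSecondForm_coeffEmbedding (e : E) :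
    reducedSecondForm F (CrossedProduct Φ) (coeffEmbedding Φ e) = extSecondForm F E e := by
  apply (algebraMap F E).injective
  have h : regularRep Φ (coeffEmbedding Φ e) = Matrix.diagonal fun τ : E ≃ₐ[F] E => τ e := by
    ext υ τ
    rw [regularRep_apply]
    by_cases h : υ = τ
    · subst h
      rw [inv_mul_cancel, coeffEmbedding_apply_one, factor_one_left, ← map_mul,
        mul_inv_cancel_left₀ (Units.ne_zero _), Matrix.diagonal_apply_eq]
    · have h' : τ⁻¹ * υ ≠ 1 := fun h' => h (inv_mul_eq_one.mp h').symm
      rw [coeffEmbedding_apply_of_ne _ h', Matrix.diagonal_apply_ne _ h, map_zero, mul_zero]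
  rw [algebraMap_reducedSecondForm, h, ← signedCoeff_two_charpoly,
    ← Algebra.charpoly_lmul_map_eq_prod, ← map_signedCoeff, card_eq_finrank]
  rfl

/-- The `(υ, τ)` entry of the matrix is a multiple of a conjugate of `x σ` with `σ = τ⁻¹ * υ`, and
the `(τ, υ)` entry involves `x σ⁻¹`. So every principal `2 × 2` minor vanishes, the diagonal by the
case `σ = 1`. -/
theorem reducedSecondForm_eq_zero {x : CrossedProduct Φ}
    (h : ∀ σ, x σ = 0 ∨ x σ⁻¹ = 0) : reducedSecondForm F (CrossedProduct Φ) x = 0 := by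
  apply (algebraMap F E).injective
  rw [algebraMap_reducedSecondForm, map_zero]
  refine Matrix.secondMinorSum_eq_zero (fun τ => ?_) fun υ τ _ => ?_
  · have h1 : x 1 = 0 := by simpa using h 1
    rw [regularRep_apply, inv_mul_cancel, h1, map_zero, mul_zero]
  · rw [regularRep_apply, regularRep_apply]
    rcases h (τ⁻¹ * υ) with h | h
    · simp [h]
    · rw [mul_inv_rev, inv_inv] at h
      simp [h]

end CrossedProduct

/-! ### Nonsingular and hyperbolic quadratic forms -/

section Witt

variable {F : Type u} [Field F] {V : Type v} {W : Type w} [AddCommGroup V] [Module F V]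
  [AddCommGroup W] [Module F W]

theorem nonsingular_iff {Q : QuadraticForm F V} :
    Nonsingular Q ↔ ∀ x, (∀ y, QuadraticMap.polar Q x y = 0) → x = 0 := by
  have hr : LinearMap.IsRefl Q.polarBilin := fun x y h => by
    rw [QuadraticMap.polarBilin_apply_apply] at h ⊢
    rwa [QuadraticMap.polar_comm]
  rw [Nonsingular, hr.nondegenerate_iff_separatingLeft]
  rfl

theorem Nonsingular.prod {Q : QuadraticForm F V} {Q' : QuadraticForm F W} (h : Nonsingular Q)
    (h' : Nonsingular Q') : Nonsingular (Q.prod Q') := by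
  rw [nonsingular_iff] at *
  rintro ⟨x, x'⟩ hx
  refine Prod.ext (h x fun y => ?_) (h' x' fun y => ?_)
  · simpa using hx (y, 0)
  · simpa using hx (0, y)

theorem Nonsingular.of_equivalent {Q : QuadraticForm F V} {Q' : QuadraticForm F W}
    (h : Nonsingular Q) (e : Q'.Equivalent Q) : Nonsingular Q' := by
  obtain ⟨e⟩ := e
  rw [nonsingular_iff] at *
  intro x hx
  refine (map_eq_zero_iff e e.toLinearEquiv.injective).mp (h (e x) fun y => ?_)
  obtain ⟨y, rfl⟩ := e.toLinearEquiv.surjective y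
  have := hx y
  simp only [QuadraticMap.polar] at this ⊢
  rw [← e.map_app, ← e.map_app x, ← e.map_app y, map_add] at this
  exact this

variable (F) in
theorem nonsingular_hyperbolicSpace (m : ℕ) : Nonsingular (hyperbolicSpace F m) := by
  classical
  rw [nonsingular_iff]
  intro x hx
  have key (i : Fin m) (y : F × F) : QuadraticMap.polar (hyperbolicPlane F) (x i) y = 0 := by
    have h := hx (Pi.single i y)
    rw [hyperbolicSpace, QuadraticMap.Ring.polar_pi, Finset.sum_eq_single i] at h
    · simpa using h
    · intro j _ hj
      simp [Pi.single_eq_of_ne hj]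
    · simp
  funext i
  refine Prod.ext ?_ ?_
  · simpa [QuadraticMap.polar, hyperbolicPlane, mul_add, add_mul] using key i (0, 1)
  · simpa [QuadraticMap.polar, hyperbolicPlane, mul_add, add_mul] using key i (1, 0)

/-- The quadratic form of a perfect pairing of two spaces is hyperbolic. -/
theorem equivalent_hyperbolicSpace [FiniteDimensional F V] [FiniteDimensional F W]
    (β : V →ₗ[F] W →ₗ[F] F) (hβ : β.Nondegenerate) (Q : QuadraticForm F (V × W))
    (hQ : ∀ p, Q p = β p.1 p.2) : Q.Equivalent (hyperbolicSpace F (Module.finrank F V)) := by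
  let b := Module.finBasis F V
  -- Coordinates of `x` in the basis `b`, and coordinates `β (b i) y` of `y` in the dual basis.
  let g : V × W →ₗ[F] (Fin (Module.finrank F V) → F × F) := LinearMap.pi fun i =>
    (b.coord i ∘ₗ LinearMap.fst F V W).prod (β (b i) ∘ₗ LinearMap.snd F V W)
  have hg : Function.Injective g := by
    refine (injective_iff_map_eq_zero g).mpr ?_
    rintro ⟨x, y⟩ h
    have h1 (i) : b.repr x i = 0 := congrArg Prod.fst (congrFun h i)
    have h2 (i) : β (b i) y = 0 := congrArg Prod.snd (congrFun h i)
    refine Prod.ext (b.repr.map_eq_zero_iff.mp (Finsupp.ext h1)) (hβ.2 y fun z => ?_)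
    have : β.flip y = 0 := b.ext h2
    exact LinearMap.congr_fun this z
  have hVW : Module.finrank F V ≤ Module.finrank F W := by
    have hi : Function.Injective β := (injective_iff_map_eq_zero β).mpr fun x h =>
      hβ.1 x fun y => by rw [h]; rfl
    simpa using LinearMap.finrank_le_finrank_of_injective hi
  have hWV : Module.finrank F W ≤ Module.finrank F V := by
    have hi : Function.Injective β.flip := (injective_iff_map_eq_zero β.flip).mpr fun y h =>
      hβ.2 y fun x => LinearMap.congr_fun h x
    simpa using LinearMap.finrank_le_finrank_of_injective hi
  have hrank : Module.finrank F (V × W) =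
      Module.finrank F (Fin (Module.finrank F V) → F × F) := by
    rw [Module.finrank_prod, Module.finrank_pi_fintype]
    simp only [Module.finrank_prod, Module.finrank_self, Finset.sum_const, Finset.card_univ,
      Fintype.card_fin, smul_eq_mul]
    lia
  refine ⟨⟨LinearEquiv.ofInjectiveOfFinrankEq g hg hrank, ?_⟩⟩
  rintro ⟨x, y⟩
  rw [hQ, hyperbolicSpace]
  have h : β x y = ∑ i, b.repr x i * β (b i) y := by
    conv_lhs => rw [← b.sum_repr x]
    simp only [map_sum, map_smul, LinearMap.sum_apply, LinearMap.smul_apply, smul_eq_mul]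
  simp [h, g, QuadraticMap.pi_apply, hyperbolicPlane]

theorem equivalent_prod_hyperbolicSpace_zero (Q : QuadraticForm F V) :
    (Q.prod (hyperbolicSpace F 0)).Equivalent Q :=
  ⟨⟨LinearEquiv.prodUnique, fun x => by simp [hyperbolicSpace, QuadraticMap.pi_apply]⟩⟩

theorem equivalent_prod_of_subsingleton [Subsingleton W] (Q : QuadraticForm F V)
    (Q' : QuadraticForm F W) : (Q.prod Q').Equivalent Q :=
  have : Unique W := uniqueOfSubsingleton 0
  ⟨⟨LinearEquiv.prodUnique, fun x => by simp [Subsingleton.elim x.2 0]⟩⟩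

theorem wittEquivalent_of_equivalent {Q : QuadraticForm F V} {Q' : QuadraticForm F W} {m : ℕ}
    (h : Nonsingular Q') (e : Q.Equivalent (Q'.prod (hyperbolicSpace F m))) :
    WittEquivalent Q Q' :=
  ⟨(h.prod (nonsingular_hyperbolicSpace F m)).of_equivalent e, h, 0, m,
    (equivalent_prod_hyperbolicSpace_zero Q).trans e⟩

end Witt

/-! ### Orthogonal decomposition of `t₂` -/

namespace CrossedProduct

open scoped Classical

variable {F : Type u} {E : Type v} [Field F] [Field E] [Algebra F E] {Φ : FactorSet F E}

variable (Φ) in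
/-- The subspace `⨁ u_σ E` with `σ` running over `s`. -/
def supported (s : Set (E ≃ₐ[F] E)) : Submodule F (CrossedProduct Φ) where
  carrier := {x | ∀ σ ∉ s, x σ = 0}
  add_mem' hx hy σ hσ := by rw [add_apply, hx σ hσ, hy σ hσ, add_zero]
  zero_mem' _ _ := rfl
  smul_mem' r x hx σ hσ := by rw [smul_apply, hx σ hσ, smul_zero]

theorem monomial_mem_supported {s : Set (E ≃ₐ[F] E)} {σ : E ≃ₐ[F] E} (hσ : σ ∈ s) (e : E) :
    monomial Φ σ e ∈ supported Φ s := fun τ hτ => by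
  have : τ ≠ σ := fun h => hτ (h ▸ hσ)
  simp [monomial, this]

/-- The component of `x` in the subspace `supported Φ s`. -/
noncomputable def component (s : Set (E ≃ₐ[F] E)) (x : CrossedProduct Φ) : supported Φ s :=
  ⟨fun σ => if σ ∈ s then x σ else 0, fun _ hσ => if_neg hσ⟩

theorem component_apply_of_mem {s : Set (E ≃ₐ[F] E)} (x : CrossedProduct Φ) {σ : E ≃ₐ[F] E}
    (h : σ ∈ s) : (component s x : CrossedProduct Φ) σ = x σ := if_pos h

theorem component_apply_of_notMem {s : Set (E ≃ₐ[F] E)} (x : CrossedProduct Φ) {σ : E ≃ₐ[F] E}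
    (h : σ ∉ s) : (component s x : CrossedProduct Φ) σ = 0 := if_neg h

theorem eq_sum_monomial [FiniteDimensional F E] (x : CrossedProduct Φ) :
    x = ∑ σ, monomial Φ σ (x σ) := by
  ext τ
  have h : (∑ σ, monomial Φ σ (x σ)) τ = ∑ σ, monomial Φ σ (x σ) τ :=
    Finset.sum_apply (M := fun _ => E) τ Finset.univ _
  rw [h, Finset.sum_eq_single τ]
  · simp [monomial]
  · intro σ _ hσ
    simp [monomial, hσ.symm]
  · simp

variable [FiniteDimensional F E]

theorem involutionSpace_eq_supported :
    involutionSpace Φ = supported Φ {ρ | ρ * ρ = 1 ∧ ρ ≠ 1} := by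
  refine le_antisymm (Submodule.span_le.mpr ?_) fun x hx => ?_
  · rintro _ ⟨ρ, e, h1, h2, rfl⟩
    exact monomial_mem_supported (by exact ⟨h1, h2⟩) e
  · rw [eq_sum_monomial x]
    refine Submodule.sum_mem _ fun ρ _ => ?_
    by_cases h : ρ * ρ = 1 ∧ ρ ≠ 1
    · exact Submodule.subset_span ⟨ρ, x ρ, h.1, h.2, rfl⟩
    · rw [hx ρ h]
      convert Submodule.zero_mem _
      ext τ
      simp [monomial]

/-- Only the products of `x τ⁻¹` with `y τ` reach the coordinate at `1`. This gives all the
orthogonality relations. -/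
theorem traceMap_mul_eq_zero {x y : CrossedProduct Φ} (h : ∀ σ, x σ⁻¹ = 0 ∨ y σ = 0) :
    traceMap Φ (x * y) = 0 := by
  have h1 : (x * y) 1 = 0 := by
    rw [mul_apply]
    refine Finset.sum_eq_zero fun τ _ => ?_
    rcases h τ with h | h <;> simp [h]
  rw [traceMap_apply, h1, mul_zero, map_zero]

theorem traceMap_eq_zero {x : CrossedProduct Φ} (h : x 1 = 0) : traceMap Φ x = 0 := by
  rw [traceMap_apply, h, mul_zero, map_zero]

theorem traceMap_mul_monomial (x : CrossedProduct Φ) (τ : E ≃ₐ[F] E) (d : E) :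
    traceMap Φ (x * monomial Φ τ d) =
      Algebra.trace F E (Φ.toFun 1 1 * (Φ.toFun τ⁻¹ τ * τ (x τ⁻¹)) * d) := by
  rw [traceMap_apply, mul_apply, Finset.sum_eq_single τ]
  · simp [monomial, mul_assoc]
  · intro κ _ hκ
    simp [monomial, hκ]
  · simp

theorem traceMap_coeffEmbedding (e : E) :
    traceMap Φ (coeffEmbedding Φ e) = Algebra.trace F E e := by
  rw [traceMap_apply, coeffEmbedding_apply_one, mul_inv_cancel_left₀ (Units.ne_zero _)]

theorem traceMap_coeffEmbedding_mul (c d : E) :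
    traceMap Φ (coeffEmbedding Φ c * coeffEmbedding Φ d) = Algebra.trace F E (c * d) := by
  have h (e : E) : coeffEmbedding Φ e = monomial Φ 1 ((Φ.toFun 1 1 : E)⁻¹ * e) := rfl
  rw [h d, traceMap_mul_monomial, inv_one, coeffEmbedding_apply_one, AlgEquiv.one_apply]
  congr 1
  have := (Φ.toFun 1 1).ne_zero
  field_simp

variable [IsGalois F E]

theorem eq_zero_of_traceMap_mul_eq_zero {x : CrossedProduct Φ} {σ : E ≃ₐ[F] E}
    (h : ∀ d, traceMap Φ (x * monomial Φ σ⁻¹ d) = 0) : x σ = 0 := by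
  have h0 := (traceForm_nondegenerate F E).1 _ fun d => by
    rw [Algebra.traceForm_apply]
    exact (traceMap_mul_monomial x σ⁻¹ d).symm.trans (h d)
  simpa using h0

theorem polar_reducedSecondForm (x y : CrossedProduct Φ) :
    QuadraticMap.polar (reducedSecondForm F (CrossedProduct Φ)) x y =
      traceMap Φ x * traceMap Φ y - traceMap Φ (x * y) := by
  rw [QuadraticMap.polar, reducedSecondForm_add]
  ring

theorem polar_extSecondForm (c d : E) : QuadraticMap.polar (extSecondForm F E) c d =
    Algebra.trace F E c * Algebra.trace F E d - Algebra.trace F E (c * d) := by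
  -- `E` embeds in the crossed product of the trivial factor set, so the polar form of `T₂` is read
  -- off from that of `t₂`.
  let Φ : FactorSet F E := ⟨fun _ _ => 1, by simp⟩
  rw [← traceMap_coeffEmbedding_mul (Φ := Φ), ← traceMap_coeffEmbedding (Φ := Φ) c,
    ← traceMap_coeffEmbedding (Φ := Φ) d, ← polar_reducedSecondForm]
  simp only [QuadraticMap.polar, ← map_add, reducedSecondForm_coeffEmbedding]

end CrossedProduct

/-- Let `c` be in the radical and `n = [E : F]`. If `n` is even, `tr(c) - c` is orthogonal to `E`
for the trace form, so `c = tr(c)` lies in `F` and `tr(c) = n tr(c) = 0`. If `n` is odd, `n = 1` in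
`F` and `E = F ⊕ ker tr`; since `tr c = 0`, `c` is also trace-orthogonal to `F`, hence to `E`. -/
theorem nonsingular_extTraceForm {F : Type u} {E : Type v} [Field F] [CharP F 2] [Field E]
    [Algebra F E] [FiniteDimensional F E] [IsGalois F E] : Nonsingular (extTraceForm F E) := by
  rw [nonsingular_iff]
  rintro ⟨c, hc⟩ h
  have hpolar (d : E) (hd : d ∈ extTraceSpace F E) :
      Algebra.trace F E c * Algebra.trace F E d = Algebra.trace F E (c * d) := by
    rw [← sub_eq_zero, ← CrossedProduct.polar_extSecondForm]
    exact h ⟨d, hd⟩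
  refine Subtype.ext ?_
  change c = 0
  by_cases hn : Even (Module.finrank F E)
  · have hn' : (Module.finrank F E : F) = 0 := (CharP.cast_eq_zero_iff F 2 _).mpr hn.two_dvd
    have hU : extTraceSpace F E = ⊤ := if_pos hn
    have h1 : algebraMap F E (Algebra.trace F E c) - c = 0 :=
      (traceForm_nondegenerate F E).1 _ fun d => by
        rw [Algebra.traceForm_apply, sub_mul, map_sub, ← hpolar d (by simp [hU]),
          ← Algebra.smul_def, map_smul, smul_eq_mul, sub_self]
    have h2 : Algebra.trace F E c = 0 := by
      rw [← sub_eq_zero.mp h1, Algebra.trace_algebraMap, nsmul_eq_mul, hn', zero_mul]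
    rw [← sub_eq_zero.mp h1, h2, map_zero]
  · have hU : extTraceSpace F E = LinearMap.ker (Algebra.trace F E) := if_neg hn
    have hn' : (Module.finrank F E : F) = 1 := by
      obtain ⟨k, hk⟩ := Nat.not_even_iff_odd.mp hn
      have h2 : (2 : F) = 0 := CharTwo.two_eq_zero
      rw [hk]; push_cast; rw [h2]; ring
    have hc0 : Algebra.trace F E c = 0 := by rwa [hU] at hc
    refine (traceForm_nondegenerate F E).1 _ fun d => ?_
    -- The projection of `d` to `ker tr` along `F`, available because `n = 1` in `F`.
    have hd : d - algebraMap F E (Algebra.trace F E d) ∈ extTraceSpace F E := by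
      rw [hU, LinearMap.mem_ker, map_sub, Algebra.trace_algebraMap, nsmul_eq_mul, hn', one_mul,
        sub_self]
    have h1 := hpolar _ hd
    rw [hc0, zero_mul, mul_sub, map_sub, mul_comm c (algebraMap F E _), ← Algebra.smul_def,
      map_smul, hc0, smul_zero, sub_zero] at h1
    rw [Algebra.traceForm_apply, ← h1]

/-! ### Half systems and the pairing of `σ` with `σ⁻¹`. -/

namespace CrossedProduct

open scoped Classical

variable {F : Type u} {E : Type v} [Field F] [Field E] [Algebra F E] {Φ : FactorSet F E}
  [FiniteDimensional F E]

variable (F E) in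
/-- A set containing exactly one of `σ`, `σ⁻¹` if `σ² ≠ 1`, and no `σ` with `σ² = 1`. -/
def halfSystem : Set (E ≃ₐ[F] E) :=
  {σ | Fintype.equivFin (E ≃ₐ[F] E) σ < Fintype.equivFin (E ≃ₐ[F] E) σ⁻¹}

theorem inv_notMem_halfSystem {σ : E ≃ₐ[F] E} (h : σ ∈ halfSystem F E) :
    σ⁻¹ ∉ halfSystem F E := by
  simp only [halfSystem, Set.mem_ofPred_eq, inv_inv, not_lt] at *
  exact h.le

theorem one_notMem_halfSystem : (1 : E ≃ₐ[F] E) ∉ halfSystem F E := by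
  simp [halfSystem]

theorem mem_halfSystem_or {σ : E ≃ₐ[F] E} (h : σ * σ ≠ 1) :
    σ ∈ halfSystem F E ∨ σ⁻¹ ∈ halfSystem F E := by
  have hne : σ ≠ σ⁻¹ := fun h' => h (mul_eq_one_iff_eq_inv.mpr h')
  simp only [halfSystem, Set.mem_ofPred_eq, inv_inv]
  exact lt_or_gt_of_ne fun h' => hne ((Fintype.equivFin _).injective h')

theorem mul_self_ne_one_of_mem_halfSystem {σ : E ≃ₐ[F] E} (h : σ ∈ halfSystem F E) :
    σ * σ ≠ 1 := fun h' => by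
  have := inv_notMem_halfSystem h
  rw [← mul_eq_one_iff_eq_inv.mp h'] at this
  exact this h

variable (Φ) in
/-- The sum over a half system. -/
noncomputable abbrev upperSpace : Submodule F (CrossedProduct Φ) :=
  supported Φ (halfSystem F E)

variable (Φ) in
/-- The sum over the inverses of a half system. -/
noncomputable abbrev lowerSpace : Submodule F (CrossedProduct Φ) :=
  supported Φ {σ | σ⁻¹ ∈ halfSystem F E}

instance (s : Set (E ≃ₐ[F] E)) : FiniteDimensional F (supported Φ s) :=
  FiniteDimensional.finiteDimensional_submodule _

variable (Φ) in
/-- The pairing `(x, y) ↦ t₁ (x y)`, up to sign. -/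
noncomputable def tracePairing : upperSpace Φ →ₗ[F] lowerSpace Φ →ₗ[F] F :=
  (-(LinearMap.mul F (CrossedProduct Φ)).compr₂ (traceMap Φ)).domRestrict₁₂ _ _

theorem tracePairing_apply (x : upperSpace Φ) (y : lowerSpace Φ) :
    tracePairing Φ x y = -traceMap Φ ((x : CrossedProduct Φ) * y) := rfl

theorem traceMap_mul_comm [IsGalois F E] (x y : CrossedProduct Φ) :
    traceMap Φ (x * y) = traceMap Φ (y * x) := by
  apply (algebraMap F E).injective
  rw [algebraMap_traceMap, algebraMap_traceMap, map_mul, map_mul, Matrix.trace_mul_comm]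

theorem tracePairing_nondegenerate [IsGalois F E] : (tracePairing Φ).Nondegenerate := by
  constructor
  · rintro ⟨x, hx⟩ h
    refine Subtype.ext (ext fun σ => ?_)
    change x σ = 0
    by_cases hσ : σ ∈ halfSystem F E
    · refine eq_zero_of_traceMap_mul_eq_zero fun d => neg_eq_zero.mp ?_
      exact h ⟨_, monomial_mem_supported (by simpa using hσ) d⟩
    · exact hx σ hσ
  · rintro ⟨y, hy⟩ h
    refine Subtype.ext (ext fun σ => ?_)
    change y σ = 0
    by_cases hσ : σ⁻¹ ∈ halfSystem F E
    · refine eq_zero_of_traceMap_mul_eq_zero fun d => neg_eq_zero.mp ?_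
      rw [traceMap_mul_comm]
      exact h ⟨_, monomial_mem_supported hσ d⟩
    · exact hy σ hσ

theorem upperSpace_apply_one (p : upperSpace Φ) : (p : CrossedProduct Φ) 1 = 0 :=
  p.2 1 one_notMem_halfSystem

theorem lowerSpace_apply_one (p : lowerSpace Φ) : (p : CrossedProduct Φ) 1 = 0 :=
  p.2 1 (by simpa using one_notMem_halfSystem)

theorem involutionSpace_apply_one (b : involutionSpace Φ) : (b : CrossedProduct Φ) 1 = 0 := by
  have h : (b : CrossedProduct Φ) ∈ supported Φ _ := involutionSpace_eq_supported.le b.2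
  exact h 1 (by simp)

theorem involutionSpace_apply_eq_zero (b : involutionSpace Φ) {σ : E ≃ₐ[F] E}
    (hσ : σ * σ ≠ 1) : (b : CrossedProduct Φ) σ = 0 := by
  have h : (b : CrossedProduct Φ) ∈ supported Φ _ := involutionSpace_eq_supported.le b.2
  exact h σ fun h' => hσ h'.1

/-! ### Assembling the orthogonal decomposition of `T_{A/F}`. -/

variable (Φ) in
/-- The sum of the components of an element of the decomposition. -/
noncomputable def assemble :
    (extTraceSpace F E × involutionSpace Φ) × (upperSpace Φ × lowerSpace Φ) →ₗ[F]
      CrossedProduct Φ :=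
  (((coeffEmbedding Φ) ∘ₗ (extTraceSpace F E).subtype).coprod (involutionSpace Φ).subtype).coprod
    ((upperSpace Φ).subtype.coprod (lowerSpace Φ).subtype)

theorem assemble_apply_apply (u : extTraceSpace F E) (b : involutionSpace Φ) (p : upperSpace Φ)
    (q : lowerSpace Φ) (σ : E ≃ₐ[F] E) : assemble Φ ((u, b), (p, q)) σ =
      coeffEmbedding Φ u σ + (b : CrossedProduct Φ) σ +
        ((p : CrossedProduct Φ) σ + (q : CrossedProduct Φ) σ) := rfl

theorem assemble_apply_one (u : extTraceSpace F E) (b : involutionSpace Φ) (p : upperSpace Φ)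
    (q : lowerSpace Φ) : assemble Φ ((u, b), (p, q)) 1 = (Φ.toFun 1 1 : E)⁻¹ * u := by
  rw [assemble_apply_apply, coeffEmbedding_apply_one, involutionSpace_apply_one,
    upperSpace_apply_one, lowerSpace_apply_one]
  simp

/-- The identity, the involutions, the half system and its inverses are disjoint subsets of `G`, so
the components can be read off coordinate by coordinate. -/
theorem assemble_injective : Function.Injective (assemble Φ) := by
  refine (injective_iff_map_eq_zero _).mpr ?_
  rintro ⟨⟨u, b⟩, p, q⟩ h
  have h0 (σ) : assemble Φ ((u, b), (p, q)) σ = 0 := congrFun h σ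
  have hu : (u : E) = 0 := by
    have := h0 1
    rw [assemble_apply_one] at this
    exact (mul_eq_zero.mp this).resolve_left (inv_ne_zero (Units.ne_zero _))
  simp only [assemble_apply_apply, hu, map_zero, zero_apply, zero_add] at h0
  have hp (σ) : (p : CrossedProduct Φ) σ = 0 := by
    by_cases hσ : σ ∈ halfSystem F E
    · have h1 := h0 σ
      rwa [involutionSpace_apply_eq_zero b (mul_self_ne_one_of_mem_halfSystem hσ),
        q.2 σ (inv_notMem_halfSystem hσ), zero_add, add_zero] at h1
    · exact p.2 σ hσ
  have hq (σ) : (q : CrossedProduct Φ) σ = 0 := by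
    by_cases hσ : σ⁻¹ ∈ halfSystem F E
    · have h1 := h0 σ
      have h2 : σ * σ ≠ 1 := fun h' => mul_self_ne_one_of_mem_halfSystem hσ <| by
        rw [← mul_inv_rev, h', inv_one]
      rwa [involutionSpace_apply_eq_zero b h2, hp, zero_add, zero_add] at h1
    · exact q.2 σ hσ
  have hb (σ) : (b : CrossedProduct Φ) σ = 0 := by
    simpa [hp, hq] using h0 σ
  exact Prod.ext (Prod.ext (Subtype.ext hu) (Subtype.ext (ext hb)))
    (Prod.ext (Subtype.ext (ext hp)) (Subtype.ext (ext hq)))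

variable [IsGalois F E]

theorem nonsingular_involutionSpace : Nonsingular
    ((reducedSecondForm F (CrossedProduct Φ)).restrict (involutionSpace Φ)) := by
  rw [nonsingular_iff]
  intro x h
  refine Subtype.ext (ext fun σ => ?_)
  change (x : CrossedProduct Φ) σ = 0
  by_cases hσ : σ * σ = 1 ∧ σ ≠ 1
  · refine eq_zero_of_traceMap_mul_eq_zero fun d => ?_
    have hmem : monomial Φ σ⁻¹ d ∈ involutionSpace Φ := by
      rw [involutionSpace_eq_supported]
      refine monomial_mem_supported (Set.mem_ofPred.mpr ⟨?_, inv_ne_one.mpr hσ.2⟩) d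
      rw [← mul_inv_rev, hσ.1, inv_one]
    have h1 : QuadraticMap.polar (reducedSecondForm F (CrossedProduct Φ)) x
      (monomial Φ σ⁻¹ d) = 0 := h ⟨_, hmem⟩
    rw [polar_reducedSecondForm, traceMap_eq_zero (involutionSpace_apply_one x), zero_mul,
      zero_sub, neg_eq_zero] at h1
    exact h1
  · by_cases h1 : σ = 1
    · rw [h1, involutionSpace_apply_one]
    · exact involutionSpace_apply_eq_zero x fun h' => hσ ⟨h', h1⟩

/-- In either parity, belonging to the space of `T_{A/F}` constrains only the component in `E`; thus
one decomposition serves both cases. -/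
theorem mem_algTraceSpace {x : CrossedProduct Φ} : x ∈ algTraceSpace F (CrossedProduct Φ) ↔
    (Φ.toFun 1 1 : E) * x 1 ∈ extTraceSpace F E := by
  rw [algTraceSpace, extTraceSpace, algDegree_eq_finrank, reducedTrace_eq]
  split_ifs
  · simp
  · rw [LinearMap.mem_ker, LinearMap.mem_ker, traceMap_apply]

theorem assemble_mem (z) : assemble Φ z ∈ algTraceSpace F (CrossedProduct Φ) := by
  obtain ⟨⟨u, b⟩, p, q⟩ := z
  rw [mem_algTraceSpace, assemble_apply_one, mul_inv_cancel_left₀ (Units.ne_zero _)]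
  exact u.2

theorem exists_assemble_eq {x : CrossedProduct Φ} (hx : x ∈ algTraceSpace F (CrossedProduct Φ)) :
    ∃ z, assemble Φ z = x := by
  let b : involutionSpace Φ := ⟨component {ρ | ρ * ρ = 1 ∧ ρ ≠ 1} x, by
    rw [involutionSpace_eq_supported]; exact Subtype.property _⟩
  have hb {σ} (h : σ * σ = 1 ∧ σ ≠ 1) : (b : CrossedProduct Φ) σ = x σ :=
    component_apply_of_mem x h
  refine ⟨((⟨_, mem_algTraceSpace.mp hx⟩, b), (component _ x, component _ x)), ext fun σ => ?_⟩
  by_cases h1 : σ = 1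
  · rw [h1, assemble_apply_one, inv_mul_cancel_left₀ (Units.ne_zero _)]
  rw [assemble_apply_apply, coeffEmbedding_apply_of_ne _ h1, zero_add]
  by_cases h2 : σ * σ = 1
  · have h3 : σ ∉ halfSystem F E := fun h => mul_self_ne_one_of_mem_halfSystem h h2
    have h4 : σ⁻¹ ∉ halfSystem F E := by rwa [← mul_eq_one_iff_eq_inv.mp h2]
    rw [hb ⟨h2, h1⟩, component_apply_of_notMem x h3,
      component_apply_of_notMem (s := {σ | σ⁻¹ ∈ halfSystem F E}) x h4, add_zero, add_zero]
  · rw [involutionSpace_apply_eq_zero b h2, zero_add]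
    by_cases h3 : σ ∈ halfSystem F E
    · rw [component_apply_of_mem x h3, component_apply_of_notMem
        (s := {σ | σ⁻¹ ∈ halfSystem F E}) x (inv_notMem_halfSystem h3), add_zero]
    · rw [component_apply_of_notMem x h3,
        component_apply_of_mem (s := {σ | σ⁻¹ ∈ halfSystem F E}) x
        ((mem_halfSystem_or h2).resolve_left h3), zero_add]

variable (Φ) in
/-- The decomposition of the underlying space of `T_{A/F}`. -/
noncomputable def assembleEquiv :
    ((extTraceSpace F E × involutionSpace Φ) × (upperSpace Φ × lowerSpace Φ)) ≃ₗ[F]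
      algTraceSpace F (CrossedProduct Φ) :=
  LinearEquiv.ofBijective ((assemble Φ).codRestrict _ assemble_mem)
    ⟨fun _ _ h => assemble_injective (congrArg Subtype.val h), fun x =>
      let ⟨z, hz⟩ := exists_assemble_eq x.2
      ⟨z, Subtype.ext hz⟩⟩

variable (Φ) in
/-- The restriction of `t₂` to the sum of all `u_σ E` with `σ² ≠ 1`. -/
noncomputable def hyperbolicPart : QuadraticForm F (upperSpace Φ × lowerSpace Φ) :=
  (reducedSecondForm F (CrossedProduct Φ)).comp
    ((upperSpace Φ).subtype.coprod (lowerSpace Φ).subtype)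

/-- Neither summand contains both `σ` and `σ⁻¹` in its support, so `t₂` vanishes on each and only
the polar term is left. -/
theorem hyperbolicPart_apply (z : upperSpace Φ × lowerSpace Φ) :
    hyperbolicPart Φ z = tracePairing Φ z.1 z.2 := by
  obtain ⟨p, q⟩ := z
  change reducedSecondForm F (CrossedProduct Φ) ((p : CrossedProduct Φ) + q) = _
  have hp : reducedSecondForm F (CrossedProduct Φ) p = 0 := reducedSecondForm_eq_zero fun σ => by
    by_cases hσ : σ ∈ halfSystem F E
    · exact .inr (p.2 _ (inv_notMem_halfSystem hσ))
    · exact .inl (p.2 _ hσ)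
  have hq : reducedSecondForm F (CrossedProduct Φ) q = 0 := reducedSecondForm_eq_zero fun σ => by
    by_cases hσ : σ ∈ halfSystem F E
    · exact .inl (q.2 _ (inv_notMem_halfSystem hσ))
    · exact .inr (q.2 _ (by simpa using hσ))
  rw [reducedSecondForm_add, hp, hq, traceMap_eq_zero (upperSpace_apply_one p),
    tracePairing_apply]
  ring

theorem algTraceForm_assembleEquiv
    (z : (extTraceSpace F E × involutionSpace Φ) × (upperSpace Φ × lowerSpace Φ)) :
    algTraceForm F (CrossedProduct Φ) (assembleEquiv Φ z) =
      (((extTraceForm F E).prod ((reducedSecondForm F (CrossedProduct Φ)).restrict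
        (involutionSpace Φ))).prod (hyperbolicPart Φ)) z := by
  obtain ⟨⟨u, b⟩, p, q⟩ := z
  change reducedSecondForm F (CrossedProduct Φ)
      (coeffEmbedding Φ u + b + ((p : CrossedProduct Φ) + q)) =
    extSecondForm F E u + reducedSecondForm F (CrossedProduct Φ) b +
      reducedSecondForm F (CrossedProduct Φ) ((p : CrossedProduct Φ) + q)
  have hb := involutionSpace_apply_one b
  have hpq : ((p : CrossedProduct Φ) + q) 1 = 0 := by
    rw [add_apply, upperSpace_apply_one, lowerSpace_apply_one, add_zero]
  have h1 : traceMap Φ (coeffEmbedding Φ u * (b : CrossedProduct Φ)) = 0 :=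
    traceMap_mul_eq_zero fun σ => by
      by_cases hσ : σ = 1
      · exact .inr (hσ ▸ hb)
      · exact .inl (coeffEmbedding_apply_of_ne _ (inv_ne_one.mpr hσ))
  -- The first factor lives on `σ² = 1`, the second on `σ² ≠ 1`, and both sets are closed under
  -- inversion.
  have h2 : traceMap Φ ((coeffEmbedding Φ u + b) * ((p : CrossedProduct Φ) + q)) = 0 :=
    traceMap_mul_eq_zero fun σ => by
      by_cases h1 : σ = 1
      · exact .inr (h1 ▸ hpq)
      by_cases h2 : σ * σ = 1
      · have h3 : σ ∉ halfSystem F E := fun h => mul_self_ne_one_of_mem_halfSystem h h2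
        have h4 : σ⁻¹ ∉ halfSystem F E := by rwa [← mul_eq_one_iff_eq_inv.mp h2]
        exact .inr (by rw [add_apply, p.2 σ h3, q.2 σ h4, add_zero])
      · have h3 : σ⁻¹ * σ⁻¹ ≠ 1 := by rwa [← mul_inv_rev, inv_ne_one]
        exact .inl (by rw [add_apply, coeffEmbedding_apply_of_ne _ (inv_ne_one.mpr h1),
          involutionSpace_apply_eq_zero b h3, add_zero])
  rw [reducedSecondForm_add (coeffEmbedding Φ (u : E) + (b : CrossedProduct Φ)), reducedSecondForm_add, h1, h2,
    traceMap_eq_zero hb, traceMap_eq_zero hpq, reducedSecondForm_coeffEmbedding]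
  ring

variable (Φ) in
theorem wittEquivalent_algTraceForm [CharP F 2] : WittEquivalent
    (algTraceForm F (CrossedProduct Φ)) ((extTraceForm F E).prod
      ((reducedSecondForm F (CrossedProduct Φ)).restrict (involutionSpace Φ))) := by
  have e : (algTraceForm F (CrossedProduct Φ)).Equivalent
      (((extTraceForm F E).prod ((reducedSecondForm F (CrossedProduct Φ)).restrict
        (involutionSpace Φ))).prod (hyperbolicPart Φ)) :=
    QuadraticMap.Equivalent.symm ⟨⟨assembleEquiv Φ, algTraceForm_assembleEquiv⟩⟩
  exact wittEquivalent_of_equivalent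
    (nonsingular_extTraceForm.prod nonsingular_involutionSpace)
    (e.trans (QuadraticMap.Equivalent.prod (.refl _)
      (equivalent_hyperbolicSpace (tracePairing Φ) tracePairing_nondegenerate _
        hyperbolicPart_apply)))

theorem involutionSpace_eq_bot (hn : Odd (Module.finrank F E)) : involutionSpace Φ = ⊥ := by
  refine Submodule.span_eq_bot.mpr ?_
  rintro _ ⟨ρ, e, h1, h2, -⟩
  have h3 : orderOf ρ = 2 := orderOf_eq_prime (by rw [pow_two, h1]) h2
  have h4 : 2 ∣ Module.finrank F E := by
    rw [← h3, ← card_eq_finrank (F := F) (E := E)]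
    exact orderOf_dvd_card
  exact absurd (even_iff_two_dvd.mpr h4) (Nat.not_even_iff_odd.mpr hn)

end CrossedProduct

open CrossedProduct in
theorem wittEquivalent_extTraceForm_of_odd {F : Type u} {E : Type v} [Field F] [CharP F 2] [Field E]
    [Algebra F E] [FiniteDimensional F E] [IsGalois F E] (Φ : FactorSet F E)
    (hn : Odd (Module.finrank F E)) :
    WittEquivalent (algTraceForm F (CrossedProduct Φ)) (extTraceForm F E) := by
  obtain ⟨h, -, m, m', e⟩ := wittEquivalent_algTraceForm Φ
  have : Subsingleton (involutionSpace Φ) := by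
    rw [involutionSpace_eq_bot hn]; infer_instance
  exact ⟨h, nonsingular_extTraceForm, m, m',
    e.trans (QuadraticMap.Equivalent.prod (equivalent_prod_of_subsingleton _ _) (.refl _))⟩

theorem theorem1 {F : Type u} {E : Type v} [Field F] [CharP F 2] [Field E] [Algebra F E]
    [FiniteDimensional F E] [IsGalois F E] (Φ : FactorSet F E) :
    HasReducedForms F (CrossedProduct Φ) ∧
    (Even (Module.finrank F E) →
      WittEquivalent (algTraceForm F (CrossedProduct Φ))
        ((extTraceForm F E).prod ((reducedSecondForm F (CrossedProduct Φ)).restrict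
          (CrossedProduct.involutionSpace Φ)))) ∧
    (Odd (Module.finrank F E) →
      WittEquivalent (algTraceForm F (CrossedProduct Φ)) (extTraceForm F E)) := by
  exact ⟨CrossedProduct.hasReducedForms Φ, fun _ => CrossedProduct.wittEquivalent_algTraceForm Φ,
    wittEquivalent_extTraceForm_of_odd Φ⟩
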